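/- Let $\mathbf m_0,\mathbf m_1,\mathbf m_2\in\mathbb R^2$ be three non-collinear points (the microphones), with the Euclidean norm and inner product. Put $d_i(\mathbf x)=\|\mathbf x-\mathbf m_i\|$, $\mathbf d_{ji}=\mathbf m_j-\mathbf m_i$, $d_{ji}=\|\mathbf d_{ji}\|$, and let the TDOA map be $$\boldsymbol\tau_2:\mathbb R^2\to\mathbb R^2,\qquad \boldsymbol\tau_2(\mathbf x)=\bigl(d_1(\mathbf x)-d_0(\mathbf x),\ d_2(\mathbf x)-d_0(\mathbf x)\bigr).$$ For $\boldsymbol\tau=(\tau_1,\tau_2)\in\mathbb R^2$ put $\tau_0=0$, $\Delta_{ji}(\boldsymbol\tau)=d_{ji}^2-(\tau_j-\tau_i)^2$, $w=\sqrt{d_{10}^2d_{20}^2-\langle\mathbf d_{10},\mathbf d_{20}\rangle^2}>0$, and $$a(\boldsymbol\tau)=\|\tau_2\mathbf d_{10}-\tau_1\mathbf d_{20}\|^2-w^2,\qquad b(\boldsymbol\tau)=\frac{\langle \tau_2\mathbf d_{10}-\tau_1\mathbf d_{20},\ \Delta_{20}(\boldsymbol\tau)\,\mathbf d_{10}-\Delta_{10}(\boldsymbol\tau)\,\mathbf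 d_{20}\rangle}{2w}.$$ Let $P_2=\{\boldsymbol\tau:\Delta_{ji}(\boldsymbol\tau)\ge 0 \text{ for } 0\le i<j\le 2\}$, $E^+=\{a>0\}$, $C^+=\{b>0\}$, $R^0=(d_{10},d_{20})$, and let $U_0$ be the connected component of $\mathring P_2\cap E^+\cap C^+$ whose closure contains $R^0$. Let $\tilde U_0=\boldsymbol\tau_2^{-1}(U_0)$, and let $r_1^+$ (resp. $r_2^+$) be the half-line of the line $\mathbf m_0\mathbf m_2$ (resp. $\mathbf m_0\mathbf m_1$) which originates from $\mathbf m_0$ (included) and does not contain $\mathbf m_2$ (resp. $\mathbf m_1$). Then $\tilde U_0$ has exactly two connected components, and they are separated by $r_1^+\cup r_2^+$, i.e. they lie in two different connected components of $\mathbb R^2\setminus(r_1^+\cup r_2^+)$. The map $\boldsymbol\tau_2$ is injective on each of the two components of $\tilde U_0$. Moreover $\boldsymbol\tau_2:\tilde U_0\to U_0$ is a double cover, i.e. a covering map all of whose fibres have exactly two points. -/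

import Mathlib

noncomputable section

/-- The Euclidean plane containing the source and the three microphones. -/
abbrev EPlane : Type := EuclideanSpace ℝ (Fin 2)

/-- The TDOA map `x ↦ (d₁(x) - d₀(x), d₂(x) - d₀(x))`, where `dᵢ(x) = ‖x - mᵢ‖`. -/
def tdoaMap (m : Fin 3 → EPlane) (x : EPlane) : ℝ × ℝ :=
  (dist x (m 1) - dist x (m 0), dist x (m 2) - dist x (m 0))

/-- The displacement vector `d_{ji} = m_j - m_i`. -/
def disp (m : Fin 3 → EPlane) (j i : Fin 3) : EPlane := m j - m i

/-- The third coordinates `(0, τ₁, τ₂)` of the lifted microphones. -/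
def height (τ : ℝ × ℝ) : Fin 3 → ℝ := ![0, τ.1, τ.2]

/-- The vector `D_{ji}(τ) = M_j(τ) - M_i(τ)` of the three-dimensional Minkowski space,
where `M_i(τ) = (m_i, τ_i)` with `τ_0 = 0`. -/
def liftedDisp (m : Fin 3 → EPlane) (τ : ℝ × ℝ) (j i : Fin 3) : EPlane × ℝ :=
  (disp m j i, height τ j - height τ i)

/-- The Minkowski squared norm (signature `(2,1)`) on `EPlane × ℝ`. -/
def minkowskiSq (X : EPlane × ℝ) : ℝ := ‖X.1‖ ^ 2 - X.2 ^ 2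

/-- The polygon `P₂`: all the vectors `D_{ji}(τ)`, `i < j`, have nonnegative squared norm. -/
def polygonP (m : Fin 3 → EPlane) : Set (ℝ × ℝ) :=
  {τ | ∀ i j : Fin 3, i < j → 0 ≤ minkowskiSq (liftedDisp m τ j i)}

/-- The Euclidean norm `‖u ∧ v‖` of a bivector (the area of a parallelogram). -/
def wedgeNorm (u v : EPlane) : ℝ := √(‖u‖ ^ 2 * ‖v‖ ^ 2 - (inner ℝ u v) ^ 2)

/-- `a(τ) = ‖τ₂ d₁₀ - τ₁ d₂₀‖² - ‖d₁₀ ∧ d₂₀‖²`. -/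
def coeffA (m : Fin 3 → EPlane) (τ : ℝ × ℝ) : ℝ :=
  ‖τ.2 • disp m 1 0 - τ.1 • disp m 2 0‖ ^ 2 - wedgeNorm (disp m 1 0) (disp m 2 0) ^ 2

/-- `b(τ) = ⟨τ₂ d₁₀ - τ₁ d₂₀, ‖D₂₀(τ)‖² d₁₀ - ‖D₁₀(τ)‖² d₂₀⟩ / (2 ‖d₁₀ ∧ d₂₀‖)`. -/
def coeffB (m : Fin 3 → EPlane) (τ : ℝ × ℝ) : ℝ :=
  inner ℝ (τ.2 • disp m 1 0 - τ.1 • disp m 2 0)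
    (minkowskiSq (liftedDisp m τ 2 0) • disp m 1 0
      - minkowskiSq (liftedDisp m τ 1 0) • disp m 2 0)
    / (2 * wedgeNorm (disp m 1 0) (disp m 2 0))

/-- `E⁺`, the exterior of the ellipse `a = 0`. -/
def ePlus (m : Fin 3 → EPlane) : Set (ℝ × ℝ) := {τ | 0 < coeffA m τ}

/-- `C⁺`, the positive side of the cubic `b = 0`. -/
def cPlus (m : Fin 3 → EPlane) : Set (ℝ × ℝ) := {τ | 0 < coeffB m τ}

/-- The vertex `R⁰ = (d₁₀, d₂₀)` of `P₂`. -/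
def vertexRZero (m : Fin 3 → EPlane) : ℝ × ℝ := (‖disp m 1 0‖, ‖disp m 2 0‖)

/-- The open set `int P₂ ∩ E⁺ ∩ C⁺`. -/
def doubleRegion (m : Fin 3 → EPlane) : Set (ℝ × ℝ) :=
  interior (polygonP m) ∩ ePlus m ∩ cPlus m

/-- `U₀`: the connected component of `int P₂ ∩ E⁺ ∩ C⁺` whose closure contains `R⁰`. -/
def regionUZero (m : Fin 3 → EPlane) : Set (ℝ × ℝ) :=
  {τ | τ ∈ doubleRegion m ∧ vertexRZero m ∈ closure (connectedComponentIn (doubleRegion m) τ)}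

/-- `Ũ₀`, the inverse image of `U₀` under the TDOA map. -/
def preimageUZero (m : Fin 3 → EPlane) : Set EPlane := tdoaMap m ⁻¹' regionUZero m

/-- The closed half-line of the line through `p` and `q` that originates from `p` and points
away from `q`. -/
def halfLineAway (p q : EPlane) : Set EPlane := {x | ∃ t : ℝ, 0 ≤ t ∧ x = p + t • (p - q)}

/-- `r₁⁺`: the half-line of the line `m₀m₂` originating from `m₀` and not containing `m₂`. -/
def rOnePlus (m : Fin 3 → EPlane) : Set EPlane := halfLineAway (m 0) (m 2)

/-- `r₂⁺`: the half-line of the line `m₀m₁` originating from `m₀` and not containing `m₁`. -/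
def rTwoPlus (m : Fin 3 → EPlane) : Set EPlane := halfLineAway (m 0) (m 1)

/-- The set of connected components of a subset `S` of a topological space. -/
def componentsOf {X : Type*} [TopologicalSpace X] (S : Set X) : Set (Set X) :=
  {A | ∃ x ∈ S, A = connectedComponentIn S x}

/-- `V` separates `A` from `B`: these lie in two different connected components of the
complement of `V`. -/
def Separates {X : Type*} [TopologicalSpace X] (V A B : Set X) : Prop :=
  ∃ C ∈ componentsOf Vᶜ, ∃ D ∈ componentsOf Vᶜ, C ≠ D ∧ A ⊆ C ∧ B ⊆ D

end

/-! Fix `τ` and let `r` be the distance from a source to the first microphone. Subtracting the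
squared distance equations leaves two linear equations for the position; as `crossDisp` is nonzero,
the source is determined by `r` (`pointAt`). The remaining equation is a quadratic in `r`
(`quad_of_tdoaMap_eq`) with reduced discriminant `D² / 4` times the product of the three gaps, `D`
being `crossDisp` (`quadDisc_eq`). On the double region there are thus two distinct real roots, both
nonnegative because `a > 0`, `b > 0` and the constant term is nonnegative.

A root fixes the other two distances only up to sign: `r + τᵢ` could be negative. It never vanishes
on the double region and is positive near the vertex `R⁰`, so connectedness of `U₀` makes it
positive throughout (`quadRoot_add_pos`). Each root therefore gives a continuous section over `U₀`,
and `sheetSign`, continuous and nonzero on the preimage, tells the two images apart. This yields the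
components, injectivity and the trivial double cover.

For separation, the rays bound a convex sector. The preimage misses the rays, since there some `τⱼ`
equals `dⱼ₀`. By the triangle inequality `sheetSign` is nonnegative in the sector, so the negative
sheet avoids it; the positive sheet enters it near `m 0` and, being connected, stays inside. -/

noncomputable section

/-! ### The quadratic equation for the distance to the first microphone -/

/-- The signed area spanned by the two displacements from the first microphone. -/
def crossDisp (m : Fin 3 → EPlane) : ℝ :=
  disp m 1 0 0 * disp m 2 0 1 - disp m 1 0 1 * disp m 2 0 0

/-- The squared Minkowski norm of the lifted displacement, as a function of `τ`. -/
def gap (m : Fin 3 → EPlane) (j i : Fin 3) (τ : ℝ × ℝ) : ℝ := minkowskiSq (liftedDisp m τ j i)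

/-- Half of the negated linear coefficient of the quadratic equation satisfied by the distance
from the source to the first microphone. -/
def quadB (m : Fin 3 → EPlane) (τ : ℝ × ℝ) : ℝ :=
  inner ℝ (τ.2 • disp m 1 0 - τ.1 • disp m 2 0)
    (gap m 2 0 τ • disp m 1 0 - gap m 1 0 τ • disp m 2 0) / 2

/-- The constant coefficient of the same quadratic equation. -/
def quadC (m : Fin 3 → EPlane) (τ : ℝ × ℝ) : ℝ :=
  ‖gap m 2 0 τ • disp m 1 0 - gap m 1 0 τ • disp m 2 0‖ ^ 2 / 4

/-- The reduced discriminant of the same quadratic equation. -/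
def quadDisc (m : Fin 3 → EPlane) (τ : ℝ × ℝ) : ℝ := quadB m τ ^ 2 - coeffA m τ * quadC m τ

/-- The root of the quadratic equation with sign `s = ±1`. -/
def quadRoot (m : Fin 3 → EPlane) (s : ℝ) (τ : ℝ × ℝ) : ℝ :=
  (quadB m τ + s * √(quadDisc m τ)) / coeffA m τ

/-- The only candidate for a source with range differences `τ` at distance `r` from the first
microphone. -/
def pointAt (m : Fin 3 → EPlane) (τ : ℝ × ℝ) (r : ℝ) : EPlane :=
  m 0 + !₂[((gap m 1 0 τ / 2 - r * τ.1) * disp m 2 0 1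
      - (gap m 2 0 τ / 2 - r * τ.2) * disp m 1 0 1) / crossDisp m,
    ((gap m 2 0 τ / 2 - r * τ.2) * disp m 1 0 0
      - (gap m 1 0 τ / 2 - r * τ.1) * disp m 2 0 0) / crossDisp m]

/-- The local inverse of the range difference map given by the root of sign `s`. -/
def sheet (m : Fin 3 → EPlane) (s : ℝ) (τ : ℝ × ℝ) : EPlane := pointAt m τ (quadRoot m s τ)

/-- A function on the plane whose sign tells the two sheets apart. -/
def sheetSign (m : Fin 3 → EPlane) (x : EPlane) : ℝ :=
  coeffA m (tdoaMap m x) * dist x (m 0) - quadB m (tdoaMap m x)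

/-! ### Coordinates, continuity and the discriminant -/

theorem norm_sq_coords (x : EPlane) : ‖x‖ ^ 2 = x 0 ^ 2 + x 1 ^ 2 := by
  rw [EuclideanSpace.norm_sq_eq, Fin.sum_univ_two]; simp

theorem inner_coords (x y : EPlane) : inner ℝ x y = x 0 * y 0 + x 1 * y 1 := by
  rw [PiLp.inner_apply, Fin.sum_univ_two]; simp [mul_comm]

theorem dist_sq_coords (x y : EPlane) : dist x y ^ 2 = (x 0 - y 0) ^ 2 + (x 1 - y 1) ^ 2 := by
  rw [dist_eq_norm, norm_sq_coords]; simp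

theorem disp_apply (m : Fin 3 → EPlane) (j i : Fin 3) (k : Fin 2) :
    disp m j i k = m j k - m i k := rfl

theorem gap_one_zero (m : Fin 3 → EPlane) (τ : ℝ × ℝ) :
    gap m 1 0 τ = ‖disp m 1 0‖ ^ 2 - τ.1 ^ 2 := by
  simp [gap, minkowskiSq, liftedDisp, height]

theorem gap_two_zero (m : Fin 3 → EPlane) (τ : ℝ × ℝ) :
    gap m 2 0 τ = ‖disp m 2 0‖ ^ 2 - τ.2 ^ 2 := by
  simp [gap, minkowskiSq, liftedDisp, height]

theorem gap_two_one (m : Fin 3 → EPlane) (τ : ℝ × ℝ) :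
    gap m 2 1 τ = ‖disp m 2 1‖ ^ 2 - (τ.2 - τ.1) ^ 2 := by
  simp [gap, minkowskiSq, liftedDisp, height]

theorem continuous_gap (m : Fin 3 → EPlane) (j i : Fin 3) : Continuous (gap m j i) := by
  unfold gap minkowskiSq liftedDisp height
  fin_cases i <;> fin_cases j <;> simp <;> fun_prop

theorem continuous_quadB (m : Fin 3 → EPlane) : Continuous (quadB m) := by
  have h1 := continuous_gap m 1 0
  have h2 := continuous_gap m 2 0
  unfold quadB
  fun_prop

theorem continuous_quadC (m : Fin 3 → EPlane) : Continuous (quadC m) := by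
  have h1 := continuous_gap m 1 0
  have h2 := continuous_gap m 2 0
  unfold quadC
  fun_prop

theorem continuous_coeffA (m : Fin 3 → EPlane) : Continuous (coeffA m) := by
  unfold coeffA
  fun_prop

theorem continuous_quadDisc (m : Fin 3 → EPlane) : Continuous (quadDisc m) := by
  have h1 := continuous_quadB m
  have h2 := continuous_quadC m
  have h3 := continuous_coeffA m
  unfold quadDisc
  fun_prop

theorem continuous_tdoaMap (m : Fin 3 → EPlane) : Continuous (tdoaMap m) := by
  unfold tdoaMap
  fun_prop

theorem continuous_sheetSign (m : Fin 3 → EPlane) : Continuous (sheetSign m) := by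
  have h1 := (continuous_quadB m).comp (continuous_tdoaMap m)
  have h2 := (continuous_coeffA m).comp (continuous_tdoaMap m)
  unfold sheetSign
  simp only [Function.comp_def] at h1 h2
  fun_prop

theorem wedgeNorm_sq (m : Fin 3 → EPlane) :
    wedgeNorm (disp m 1 0) (disp m 2 0) ^ 2 = crossDisp m ^ 2 := by
  have h : ‖disp m 1 0‖ ^ 2 * ‖disp m 2 0‖ ^ 2 - inner ℝ (disp m 1 0) (disp m 2 0) ^ 2
      = crossDisp m ^ 2 := by
    rw [norm_sq_coords, norm_sq_coords, inner_coords, crossDisp]; ring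
  rw [wedgeNorm, h, Real.sq_sqrt (sq_nonneg _)]

theorem coeffA_coords (m : Fin 3 → EPlane) (τ : ℝ × ℝ) :
    coeffA m τ = (τ.2 * disp m 1 0 0 - τ.1 * disp m 2 0 0) ^ 2
      + (τ.2 * disp m 1 0 1 - τ.1 * disp m 2 0 1) ^ 2 - crossDisp m ^ 2 := by
  rw [coeffA, wedgeNorm_sq, norm_sq_coords]
  simp

theorem quadB_coords (m : Fin 3 → EPlane) (τ : ℝ × ℝ) :
    quadB m τ = ((τ.2 * disp m 1 0 0 - τ.1 * disp m 2 0 0)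
        * (gap m 2 0 τ * disp m 1 0 0 - gap m 1 0 τ * disp m 2 0 0)
      + (τ.2 * disp m 1 0 1 - τ.1 * disp m 2 0 1)
        * (gap m 2 0 τ * disp m 1 0 1 - gap m 1 0 τ * disp m 2 0 1)) / 2 := by
  rw [quadB, inner_coords]
  simp

theorem quadC_coords (m : Fin 3 → EPlane) (τ : ℝ × ℝ) :
    quadC m τ = ((gap m 2 0 τ * disp m 1 0 0 - gap m 1 0 τ * disp m 2 0 0) ^ 2
      + (gap m 2 0 τ * disp m 1 0 1 - gap m 1 0 τ * disp m 2 0 1) ^ 2) / 4 := by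
  rw [quadC, norm_sq_coords]
  simp

theorem quadC_nonneg (m : Fin 3 → EPlane) (τ : ℝ × ℝ) : 0 ≤ quadC m τ := by
  unfold quadC; positivity

/-- Lagrange's identity for the two vectors in `quadB`, whose cross product is `D * (τ₁ g₂ - τ₂
g₁)`, turns the discriminant into an expression that factors. Its sign is then visible from the
polygon. -/
theorem quadDisc_eq (m : Fin 3 → EPlane) (τ : ℝ × ℝ) :
    quadDisc m τ = crossDisp m ^ 2 / 4 * (gap m 1 0 τ * gap m 2 0 τ * gap m 2 1 τ) := by
  have h1 := gap_one_zero m τ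
  have h2 := gap_two_zero m τ
  have h3 := gap_two_one m τ
  have e : disp m 2 1 = disp m 2 0 - disp m 1 0 := by simp [disp]
  rw [e] at h3
  rw [norm_sq_coords] at h1 h2 h3
  simp only [PiLp.sub_apply] at h3
  rw [quadDisc, coeffA_coords, quadB_coords, quadC_coords]
  have hC : crossDisp m = disp m 1 0 0 * disp m 2 0 1 - disp m 1 0 1 * disp m 2 0 0 := rfl
  generalize disp m 1 0 0 = u₀ at *
  generalize disp m 1 0 1 = u₁ at *
  generalize disp m 2 0 0 = v₀ at *
  generalize disp m 2 0 1 = v₁ at *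
  generalize gap m 1 0 τ = g₁ at *
  generalize gap m 2 0 τ = g₂ at *
  generalize crossDisp m = D at *
  have key : ∀ p₀ p₁ q₀ q₁ : ℝ, p₀ * q₁ - p₁ * q₀ = D * (τ.1 * g₂ - τ.2 * g₁) →
      ((p₀ * q₀ + p₁ * q₁) / 2) ^ 2 - (p₀ ^ 2 + p₁ ^ 2 - D ^ 2) * ((q₀ ^ 2 + q₁ ^ 2) / 4)
        = D ^ 2 / 4 * (q₀ ^ 2 + q₁ ^ 2 - (τ.1 * g₂ - τ.2 * g₁) ^ 2) := by
    intro p₀ p₁ q₀ q₁ h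
    linear_combination -(p₀ * q₁ - p₁ * q₀ + D * (τ.1 * g₂ - τ.2 * g₁)) / 4 * h
  rw [key _ _ _ _ (by rw [hC]; ring)]
  linear_combination D ^ 2 / 4 * ((g₁ * g₂ - g₂ ^ 2) * h1 + (g₁ * g₂ - g₁ ^ 2) * h2
    - g₁ * g₂ * h3)

theorem crossDisp_ne_zero {m : Fin 3 → EPlane} (hm : ¬ Collinear ℝ (Set.range m)) :
    crossDisp m ≠ 0 := by
  intro h
  apply hm
  rw [collinear_iff_of_mem (Set.mem_range_self 0)]
  simp only [crossDisp] at h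
  by_cases hu : disp m 1 0 = 0
  · refine ⟨disp m 2 0, ?_⟩
    rintro _ ⟨i, rfl⟩
    fin_cases i
    · exact ⟨0, by simp⟩
    · exact ⟨0, by simpa [disp, sub_eq_zero] using hu⟩
    · exact ⟨1, by simp [disp]⟩
  · refine ⟨disp m 1 0, ?_⟩
    have hn : disp m 1 0 0 ^ 2 + disp m 1 0 1 ^ 2 ≠ 0 := by
      rw [← norm_sq_coords]; simpa using hu
    rintro _ ⟨i, rfl⟩
    fin_cases i
    · exact ⟨0, by simp⟩
    · exact ⟨1, by simp [disp]⟩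
    · refine ⟨(disp m 1 0 0 * disp m 2 0 0 + disp m 1 0 1 * disp m 2 0 1)
        / (disp m 1 0 0 ^ 2 + disp m 1 0 1 ^ 2), ?_⟩
      have key : disp m 2 0 = ((disp m 1 0 0 * disp m 2 0 0 + disp m 1 0 1 * disp m 2 0 1)
        / (disp m 1 0 0 ^ 2 + disp m 1 0 1 ^ 2)) • disp m 1 0 := by
        ext k
        fin_cases k
        · simp only [Fin.zero_eta, PiLp.smul_apply, smul_eq_mul]
          rw [div_mul_eq_mul_div, eq_div_iff hn]
          linear_combination -disp m 1 0 1 * h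
        · simp only [Fin.mk_one, PiLp.smul_apply, smul_eq_mul]
          rw [div_mul_eq_mul_div, eq_div_iff hn]
          linear_combination disp m 1 0 0 * h
      change m 2 = _ + m 0
      rw [← key]
      simp [disp]

/-! ### Sources with given range differences versus roots -/

theorem dist_eq_of_tdoaMap_eq {m : Fin 3 → EPlane} {x : EPlane} {τ : ℝ × ℝ}
    (h : tdoaMap m x = τ) :
    dist x (m 1) = dist x (m 0) + τ.1 ∧ dist x (m 2) = dist x (m 0) + τ.2 := by
  subst h
  simp [tdoaMap]

theorem inner_of_tdoaMap_eq {m : Fin 3 → EPlane} {x : EPlane} {τ : ℝ × ℝ}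
    (h : tdoaMap m x = τ) :
    (x 0 - m 0 0) * disp m 1 0 0 + (x 1 - m 0 1) * disp m 1 0 1
        = gap m 1 0 τ / 2 - dist x (m 0) * τ.1 ∧
      (x 0 - m 0 0) * disp m 2 0 0 + (x 1 - m 0 1) * disp m 2 0 1
        = gap m 2 0 τ / 2 - dist x (m 0) * τ.2 := by
  obtain ⟨h1, h2⟩ := dist_eq_of_tdoaMap_eq h
  have e0 := dist_sq_coords x (m 0)
  have e1 := dist_sq_coords x (m 1)
  have e2 := dist_sq_coords x (m 2)
  rw [h1] at e1
  rw [h2] at e2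
  rw [gap_one_zero, gap_two_zero, norm_sq_coords, norm_sq_coords]
  simp only [disp_apply]
  constructor
  · linear_combination (e1 - e0) / 2
  · linear_combination (e2 - e0) / 2

/-- Cramer's rule for the two linear equations. -/
theorem pointAt_of_tdoaMap_eq {m : Fin 3 → EPlane} (hD : crossDisp m ≠ 0) {x : EPlane} {τ : ℝ × ℝ}
    (h : tdoaMap m x = τ) : pointAt m τ (dist x (m 0)) = x := by
  obtain ⟨h1, h2⟩ := inner_of_tdoaMap_eq h
  rw [pointAt, ← h1, ← h2]
  ext k
  fin_cases k
  · simp only [Fin.zero_eta, PiLp.add_apply, Matrix.cons_val_zero]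
    field_simp
    rw [crossDisp]; ring
  · simp only [Fin.mk_one, PiLp.add_apply, Matrix.cons_val_one,
      Matrix.cons_val_fin_one]
    field_simp
    rw [crossDisp]; ring

theorem quad_of_tdoaMap_eq {m : Fin 3 → EPlane} {x : EPlane} {τ : ℝ × ℝ} (h : tdoaMap m x = τ) :
    coeffA m τ * dist x (m 0) ^ 2 - 2 * quadB m τ * dist x (m 0) + quadC m τ = 0 := by
  obtain ⟨h1, h2⟩ := inner_of_tdoaMap_eq h
  have e0 := dist_sq_coords x (m 0)
  rw [coeffA_coords, quadB_coords, quadC_coords]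
  have g1 : gap m 1 0 τ = 2 * ((x 0 - m 0 0) * disp m 1 0 0 + (x 1 - m 0 1) * disp m 1 0 1
    + dist x (m 0) * τ.1) := by linear_combination -2 * h1
  have g2 : gap m 2 0 τ = 2 * ((x 0 - m 0 0) * disp m 2 0 0 + (x 1 - m 0 1) * disp m 2 0 1
    + dist x (m 0) * τ.2) := by linear_combination -2 * h2
  rw [g1, g2, crossDisp]
  linear_combination -(disp m 1 0 0 * disp m 2 0 1 - disp m 1 0 1 * disp m 2 0 0) ^ 2 * e0

/-- The squared distances from `pointAt m τ r` to the microphones, when `r` is a root. -/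
theorem dist_sq_pointAt {m : Fin 3 → EPlane} (hD : crossDisp m ≠ 0) {τ : ℝ × ℝ} {r : ℝ}
    (hr : coeffA m τ * r ^ 2 - 2 * quadB m τ * r + quadC m τ = 0) :
    dist (pointAt m τ r) (m 0) ^ 2 = r ^ 2 ∧ dist (pointAt m τ r) (m 1) ^ 2 = (r + τ.1) ^ 2 ∧
      dist (pointAt m τ r) (m 2) ^ 2 = (r + τ.2) ^ 2 := by
  set x := pointAt m τ r with hx
  have x0 : (x 0 - m 0 0) * crossDisp m = (gap m 1 0 τ / 2 - r * τ.1) * disp m 2 0 1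
      - (gap m 2 0 τ / 2 - r * τ.2) * disp m 1 0 1 := by
    rw [hx, pointAt]
    simp only [PiLp.add_apply, Matrix.cons_val_zero]
    field_simp
    ring
  have x1 : (x 1 - m 0 1) * crossDisp m = (gap m 2 0 τ / 2 - r * τ.2) * disp m 1 0 0
      - (gap m 1 0 τ / 2 - r * τ.1) * disp m 2 0 0 := by
    rw [hx, pointAt]
    simp only [PiLp.add_apply, Matrix.cons_val_one, Matrix.cons_val_fin_one]
    field_simp
    ring
  have e0 := dist_sq_coords x (m 0)
  have e1 := dist_sq_coords x (m 1)
  have e2 := dist_sq_coords x (m 2)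
  have hC : crossDisp m = disp m 1 0 0 * disp m 2 0 1 - disp m 1 0 1 * disp m 2 0 0 := rfl
  have i1 : (x 0 - m 0 0) * disp m 1 0 0 + (x 1 - m 0 1) * disp m 1 0 1
      = gap m 1 0 τ / 2 - r * τ.1 := by
    apply mul_right_cancel₀ hD
    linear_combination disp m 1 0 0 * x0 + disp m 1 0 1 * x1 -
      (gap m 1 0 τ / 2 - r * τ.1) * hC
  have i2 : (x 0 - m 0 0) * disp m 2 0 0 + (x 1 - m 0 1) * disp m 2 0 1
      = gap m 2 0 τ / 2 - r * τ.2 := by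
    apply mul_right_cancel₀ hD
    linear_combination disp m 2 0 0 * x0 + disp m 2 0 1 * x1 -
      (gap m 2 0 τ / 2 - r * τ.2) * hC
  have d0 : dist x (m 0) ^ 2 = r ^ 2 := by
    apply mul_right_cancel₀ (pow_ne_zero 2 hD)
    rw [coeffA_coords, quadB_coords, quadC_coords] at hr
    rw [e0]
    have : ((x 0 - m 0 0) ^ 2 + (x 1 - m 0 1) ^ 2) * crossDisp m ^ 2
      = ((x 0 - m 0 0) * crossDisp m) ^ 2 + ((x 1 - m 0 1) * crossDisp m) ^ 2 := by ring
    rw [this, x0, x1]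
    linear_combination hr
  refine ⟨d0, ?_, ?_⟩
  · rw [gap_one_zero, norm_sq_coords] at i1
    simp only [disp_apply] at i1
    linear_combination e1 - e0 + d0 - 2 * i1
  · rw [gap_two_zero, norm_sq_coords] at i2
    simp only [disp_apply] at i2
    linear_combination e2 - e0 + d0 - 2 * i2

/-! ### Inequalities describing the polygon and the double region -/

theorem abs_inner_lt_of_cross_ne_zero {x y : EPlane} (h : x 0 * y 1 - x 1 * y 0 ≠ 0) :
    |inner ℝ x y| < ‖x‖ * ‖y‖ := by
  apply abs_lt_of_sq_lt_sq _ (by positivity)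
  rw [mul_pow, norm_sq_coords, norm_sq_coords, inner_coords]
  have : 0 < (x 0 * y 1 - x 1 * y 0) ^ 2 := by positivity
  nlinarith

theorem disp_one_zero_ne_zero {m : Fin 3 → EPlane} (hD : crossDisp m ≠ 0) : disp m 1 0 ≠ 0 := by
  intro h; simp [crossDisp, h] at hD

theorem disp_two_zero_ne_zero {m : Fin 3 → EPlane} (hD : crossDisp m ≠ 0) : disp m 2 0 ≠ 0 := by
  intro h; simp [crossDisp, h] at hD

theorem disp_two_one_ne_zero {m : Fin 3 → EPlane} (hD : crossDisp m ≠ 0) : disp m 2 1 ≠ 0 := by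
  intro h
  have e : disp m 2 0 = disp m 1 0 := by
    rw [disp, sub_eq_zero] at h
    rw [disp, disp, h]
  apply hD
  rw [crossDisp, e]; ring

theorem mem_polygonP_iff (m : Fin 3 → EPlane) (τ : ℝ × ℝ) :
    τ ∈ polygonP m ↔ 0 ≤ gap m 1 0 τ ∧ 0 ≤ gap m 2 0 τ ∧ 0 ≤ gap m 2 1 τ := by
  constructor
  · intro h
    exact ⟨h 0 1 (by decide), h 0 2 (by decide), h 1 2 (by decide)⟩
  · rintro ⟨h1, h2, h3⟩ i j hij
    fin_cases i <;> fin_cases j <;>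
      first | exact h1 | exact h2 | exact h3 | exact absurd hij (by decide)

theorem mem_interior_polygonP_iff {m : Fin 3 → EPlane} (hD : crossDisp m ≠ 0) (τ : ℝ × ℝ) :
    τ ∈ interior (polygonP m) ↔ 0 < gap m 1 0 τ ∧ 0 < gap m 2 0 τ ∧ 0 < gap m 2 1 τ := by
  constructor
  · intro h
    -- A point of the interior can be pushed slightly away from the origin without leaving the
    -- polygon, which forces each gap to be strictly positive.
    have ht : Filter.Tendsto (fun t : ℝ => t • τ) (nhdsWithin 1 (Set.Ioi 1)) (nhds τ) := by
      have hc : Continuous fun t : ℝ => t • τ := by fun_prop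
      simpa using (hc.tendsto 1).mono_left nhdsWithin_le_nhds
    obtain ⟨t, hP, ht⟩ := ((ht.eventually (mem_interior_iff_mem_nhds.1 h)).and
      self_mem_nhdsWithin).exists
    have ht1 : (1 : ℝ) < t ^ 2 := by
      have : (1 : ℝ) < t := ht
      nlinarith
    replace hP := (mem_polygonP_iff m _).1 hP
    rw [gap_one_zero, gap_two_zero, gap_two_one] at hP
    rw [gap_one_zero, gap_two_zero, gap_two_one]
    simp only [Prod.smul_fst, Prod.smul_snd, smul_eq_mul, ← mul_sub, mul_pow] at hP
    have key : ∀ y n : ℝ, 0 < n → 0 ≤ n - t ^ 2 * y ^ 2 → 0 < n - y ^ 2 := by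
      intro y n hn h
      rcases eq_or_ne y 0 with rfl | hy
      · simpa using hn
      · have : 0 < y ^ 2 := by positivity
        nlinarith
    have h1 := norm_pos_iff.2 (disp_one_zero_ne_zero hD)
    have h2 := norm_pos_iff.2 (disp_two_zero_ne_zero hD)
    have h3 := norm_pos_iff.2 (disp_two_one_ne_zero hD)
    exact ⟨key _ _ (by positivity) hP.1, key _ _ (by positivity) hP.2.1,
      key _ _ (by positivity) hP.2.2⟩
  · intro h
    have ho : IsOpen {τ | 0 < gap m 1 0 τ ∧ 0 < gap m 2 0 τ ∧ 0 < gap m 2 1 τ} :=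
      (isOpen_lt continuous_const (continuous_gap m 1 0)).inter
        ((isOpen_lt continuous_const (continuous_gap m 2 0)).inter
          (isOpen_lt continuous_const (continuous_gap m 2 1)))
    refine interior_maximal ?_ ho h
    intro σ hσ
    exact (mem_polygonP_iff m σ).2 ⟨hσ.1.le, hσ.2.1.le, hσ.2.2.le⟩

theorem mem_doubleRegion_iff {m : Fin 3 → EPlane} (hD : crossDisp m ≠ 0) (τ : ℝ × ℝ) :
    τ ∈ doubleRegion m ↔ (0 < gap m 1 0 τ ∧ 0 < gap m 2 0 τ ∧ 0 < gap m 2 1 τ) ∧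
      0 < coeffA m τ ∧ 0 < quadB m τ := by
  have hw : 0 < wedgeNorm (disp m 1 0) (disp m 2 0) := by
    have h0 : 0 ≤ wedgeNorm (disp m 1 0) (disp m 2 0) := Real.sqrt_nonneg _
    have h1 : wedgeNorm (disp m 1 0) (disp m 2 0) ≠ 0 := by
      intro h
      have := wedgeNorm_sq m
      rw [h] at this
      exact hD (by simpa using this.symm)
    positivity
  have hB : 0 < coeffB m τ ↔ 0 < quadB m τ := by
    have e : coeffB m τ = quadB m τ / wedgeNorm (disp m 1 0) (disp m 2 0) := by
      rw [coeffB, quadB, gap, gap, div_div]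
    rw [e]
    exact div_pos_iff_of_pos_right hw
  rw [← mem_interior_polygonP_iff hD, ← hB, doubleRegion, Set.inter_assoc]
  rfl

theorem quadDisc_pos {m : Fin 3 → EPlane} (hD : crossDisp m ≠ 0) {τ : ℝ × ℝ}
    (h : τ ∈ doubleRegion m) : 0 < quadDisc m τ := by
  obtain ⟨⟨h1, h2, h3⟩, -⟩ := (mem_doubleRegion_iff hD τ).1 h
  rw [quadDisc_eq]
  positivity

/-! ### The two roots and their sheets -/

theorem coeffA_mul_quadRoot_sub {m : Fin 3 → EPlane} (hD : crossDisp m ≠ 0) {τ : ℝ × ℝ}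
    (h : τ ∈ doubleRegion m) (s : ℝ) :
    coeffA m τ * quadRoot m s τ - quadB m τ = s * √(quadDisc m τ) := by
  have ha := ((mem_doubleRegion_iff hD τ).1 h).2.1.ne'
  rw [quadRoot]
  field_simp
  ring

theorem quadRoot_eq {m : Fin 3 → EPlane} (hD : crossDisp m ≠ 0) {τ : ℝ × ℝ}
    (h : τ ∈ doubleRegion m) {s : ℝ} (hs : s ^ 2 = 1) :
    coeffA m τ * quadRoot m s τ ^ 2 - 2 * quadB m τ * quadRoot m s τ + quadC m τ = 0 := by
  have ha := ((mem_doubleRegion_iff hD τ).1 h).2.1.ne'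
  have h1 := coeffA_mul_quadRoot_sub hD h s
  have h2 := Real.sq_sqrt (quadDisc_pos hD h).le
  have h3 : quadDisc m τ = quadB m τ ^ 2 - coeffA m τ * quadC m τ := rfl
  apply mul_left_cancel₀ ha
  linear_combination (coeffA m τ * quadRoot m s τ - quadB m τ + s * √(quadDisc m τ)) * h1
    + √(quadDisc m τ) ^ 2 * hs + h2 + h3

theorem quadRoot_nonneg {m : Fin 3 → EPlane} (hD : crossDisp m ≠ 0) {τ : ℝ × ℝ}
    (h : τ ∈ doubleRegion m) {s : ℝ} (hs : s ^ 2 = 1) : 0 ≤ quadRoot m s τ := by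
  obtain ⟨-, ha, hb⟩ := (mem_doubleRegion_iff hD τ).1 h
  have hle : √(quadDisc m τ) ≤ quadB m τ := by
    rw [Real.sqrt_le_left hb.le, quadDisc]
    have := mul_nonneg ha.le (quadC_nonneg m τ)
    linarith
  have h0 := Real.sqrt_nonneg (quadDisc m τ)
  apply div_nonneg _ ha.le
  rcases sq_eq_sq_iff_eq_or_eq_neg.1 (hs.trans (one_pow 2).symm) with rfl | rfl <;> linarith

theorem continuousOn_quadRoot {m : Fin 3 → EPlane} (hD : crossDisp m ≠ 0) (s : ℝ) :
    ContinuousOn (quadRoot m s) (doubleRegion m) := by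
  unfold quadRoot
  have h1 := continuous_quadB m
  have h2 := continuous_quadDisc m
  have h3 := continuous_coeffA m
  apply ContinuousOn.div (by fun_prop) (by fun_prop)
  intro τ hτ
  exact ((mem_doubleRegion_iff hD τ).1 hτ).2.1.ne'

theorem continuousOn_sheet {m : Fin 3 → EPlane} (hD : crossDisp m ≠ 0) (s : ℝ) :
    ContinuousOn (sheet m s) (doubleRegion m) := by
  have h1 := continuousOn_quadRoot hD s
  have h2 := continuous_gap m 1 0
  have h3 := continuous_gap m 2 0
  unfold sheet pointAt
  refine continuousOn_const.add ?_
  refine (PiLp.continuous_toLp 2 _).comp_continuousOn ?_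
  rw [continuousOn_pi]
  intro i
  fin_cases i
  · simp only [Fin.zero_eta, Matrix.cons_val_zero]
    fun_prop
  · simp only [Fin.mk_one, Matrix.cons_val_one, Matrix.cons_val_fin_one]
    fun_prop

/-- Completing the square in the quadratic equation. -/
theorem sheetSign_sq (m : Fin 3 → EPlane) (x : EPlane) :
    sheetSign m x ^ 2 = quadDisc m (tdoaMap m x) := by
  have := quad_of_tdoaMap_eq (m := m) (x := x) rfl
  rw [sheetSign, quadDisc]
  linear_combination coeffA m (tdoaMap m x) * this

theorem sheet_of_sheetSign {m : Fin 3 → EPlane} (hD : crossDisp m ≠ 0) {x : EPlane}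
    (hx : tdoaMap m x ∈ doubleRegion m) {s : ℝ} (hs : s ^ 2 = 1) (h : 0 < s * sheetSign m x) :
    sheet m s (tdoaMap m x) = x := by
  have ha := ((mem_doubleRegion_iff hD _).1 hx).2.1.ne'
  have h1 : s * sheetSign m x = √(quadDisc m (tdoaMap m x)) := by
    rw [← sheetSign_sq, ← one_mul (sheetSign m x ^ 2), ← hs, ← mul_pow, Real.sqrt_sq h.le]
  have h2 : quadRoot m s (tdoaMap m x) = dist x (m 0) := by
    rw [quadRoot, ← h1, div_eq_iff ha, ← mul_assoc, ← sq, hs, sheetSign]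
    ring
  rw [sheet, h2, pointAt_of_tdoaMap_eq hD rfl]

/-! ### The vertex and the connectedness of the region -/

/-- The part of the open quadrant with vertex `vertexRZero m` at distance less than `δ`. -/
def corner (m : Fin 3 → EPlane) (δ : ℝ) : Set (ℝ × ℝ) :=
  Metric.ball (vertexRZero m) δ ∩ {τ | τ.1 < ‖disp m 1 0‖ ∧ τ.2 < ‖disp m 2 0‖}

/-- At the vertex two gaps vanish, hence so does `quadB`, and continuity alone cannot give its sign.
It is split as a combination of those gaps with inner products whose signs are strict at the vertex
by strict Cauchy–Schwarz. -/
theorem exists_corner {m : Fin 3 → EPlane} (hD : crossDisp m ≠ 0) :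
    ∃ δ > 0, corner m δ = Metric.ball (vertexRZero m) δ ∩ doubleRegion m ∧
      ∀ τ ∈ corner m δ, 0 < τ.1 ∧ 0 < τ.2 := by
  have hu := norm_pos_iff.2 (disp_one_zero_ne_zero hD)
  have hv := norm_pos_iff.2 (disp_two_zero_ne_zero hD)
  have hK : inner ℝ (disp m 1 0) (disp m 2 0) < ‖disp m 1 0‖ * ‖disp m 2 0‖ :=
    (abs_lt.1 (abs_inner_lt_of_cross_ne_zero hD)).2
  set u := disp m 1 0 with hu'
  set v := disp m 2 0 with hv'
  have e21 : disp m 2 1 = v - u := by simp [disp, hu', hv']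
  have c1 := continuous_gap m 2 1
  have c2 := continuous_coeffA m
  have hgram : wedgeNorm u v ^ 2 = ‖u‖ ^ 2 * ‖v‖ ^ 2 - inner ℝ u v ^ 2 := by
    rw [wedgeNorm, Real.sq_sqrt]
    have := abs_real_inner_le_norm u v
    rw [← mul_pow, ← sq_abs (inner ℝ u v)]
    have := pow_le_pow_left₀ (abs_nonneg _) this 2
    linarith
  have ev : ∀ᶠ τ in nhds (vertexRZero m), 0 < τ.1 ∧ 0 < τ.2 ∧ 0 < gap m 2 1 τ ∧ 0 < coeffA m τ ∧
      0 < inner ℝ (τ.2 • u - τ.1 • v) u ∧ inner ℝ (τ.2 • u - τ.1 • v) v < 0 := by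
    refine Filter.Eventually.and ?_ (Filter.Eventually.and ?_ (Filter.Eventually.and ?_
      (Filter.Eventually.and ?_ (Filter.Eventually.and ?_ ?_))))
    · exact continuousAt_const.eventually_lt continuous_fst.continuousAt hu
    · exact continuousAt_const.eventually_lt continuous_snd.continuousAt hv
    · refine continuousAt_const.eventually_lt c1.continuousAt ?_
      rw [gap_two_one, e21, norm_sub_sq_real, real_inner_comm, vertexRZero]
      simp only [← hu', ← hv']
      nlinarith
    · refine continuousAt_const.eventually_lt c2.continuousAt ?_
      rw [coeffA, norm_sub_sq_real, norm_smul, norm_smul, inner_smul_left, inner_smul_right,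
        hgram, vertexRZero]
      simp only [← hu', ← hv', norm_norm, conj_trivial]
      have := mul_pos (sub_pos.2 hK) (sub_pos.2 hK)
      nlinarith
    · refine continuousAt_const.eventually_lt (by fun_prop) ?_
      simp only [inner_sub_left, inner_smul_left, conj_trivial, vertexRZero, ← hu', ← hv',
        real_inner_self_eq_norm_sq, real_inner_comm u v]
      have := mul_pos hu (sub_pos.2 hK)
      nlinarith
    · refine ContinuousAt.eventually_lt (by fun_prop) continuousAt_const ?_
      simp only [inner_sub_left, inner_smul_left, conj_trivial, vertexRZero, ← hu', ← hv',
        real_inner_self_eq_norm_sq]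
      have := mul_pos hv (sub_pos.2 hK)
      nlinarith
  obtain ⟨δ, hδ, hball⟩ := Metric.eventually_nhds_iff_ball.1 ev
  refine ⟨δ, hδ, ?_, fun τ hτ => ⟨(hball τ hτ.1).1, (hball τ hτ.1).2.1⟩⟩
  rw [corner]
  ext τ
  refine and_congr_right fun hτ => ?_
  obtain ⟨p1, p2, p3, p4, p5, p6⟩ := hball τ hτ
  rw [mem_doubleRegion_iff hD, gap_one_zero, gap_two_zero, ← hu', ← hv']
  constructor
  · rintro ⟨q1, q2⟩
    have g1 : 0 < ‖u‖ ^ 2 - τ.1 ^ 2 := by nlinarith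
    have g2 : 0 < ‖v‖ ^ 2 - τ.2 ^ 2 := by nlinarith
    refine ⟨⟨g1, g2, p3⟩, p4, ?_⟩
    rw [quadB, gap_one_zero, gap_two_zero, ← hu', ← hv', inner_sub_right, inner_smul_right,
      inner_smul_right]
    have := mul_pos g2 p5
    have := mul_neg_of_pos_of_neg g1 p6
    linarith
  · rintro ⟨⟨g1, g2, -⟩, -⟩
    exact ⟨by nlinarith, by nlinarith⟩

theorem isPreconnected_corner (m : Fin 3 → EPlane) (δ : ℝ) : IsPreconnected (corner m δ) := by
  refine ((convex_ball _ _).inter ?_).isPreconnected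
  have h : {τ : ℝ × ℝ | τ.1 < ‖disp m 1 0‖ ∧ τ.2 < ‖disp m 2 0‖}
      = Set.Iio ‖disp m 1 0‖ ×ˢ Set.Iio ‖disp m 2 0‖ := rfl
  rw [h]
  exact (convex_Iio _).prod (convex_Iio _)

theorem corner_inter_ball_nonempty (m : Fin 3 → EPlane) {δ ε : ℝ} (hδ : 0 < δ) (hε : 0 < ε) :
    (Metric.ball (vertexRZero m) ε ∩ corner m δ).Nonempty := by
  have hη : 0 < min δ ε / 2 := by positivity
  have hmem : ∀ ρ, min δ ε ≤ ρ → (‖disp m 1 0‖ - min δ ε / 2, ‖disp m 2 0‖ - min δ ε / 2) ∈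
      Metric.ball (vertexRZero m) ρ := by
    intro ρ hρ
    rw [Metric.mem_ball, vertexRZero, Prod.dist_eq, Real.dist_eq, Real.dist_eq, max_lt_iff]
    simp only [sub_sub_cancel_left, abs_neg, abs_of_pos hη]
    constructor <;> linarith
  refine ⟨_, hmem ε (min_le_right _ _), hmem δ (min_le_left _ _), ?_, ?_⟩
  · simpa using hη
  · simpa using hη

/-- Any component adherent to the vertex meets the corner, which is connected and lies in the double
region; so only one component qualifies. -/
theorem isPreconnected_regionUZero_and_corner_subset {m : Fin 3 → EPlane} {δ : ℝ} (hδ : 0 < δ)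
    (h : corner m δ = Metric.ball (vertexRZero m) δ ∩ doubleRegion m) :
    IsPreconnected (regionUZero m) ∧ corner m δ ⊆ regionUZero m := by
  obtain ⟨τ₀, -, hτ₀⟩ := corner_inter_ball_nonempty m hδ hδ
  have hsub : corner m δ ⊆ doubleRegion m := by rw [h]; exact Set.inter_subset_right
  have hcomp : corner m δ ⊆ connectedComponentIn (doubleRegion m) τ₀ :=
    (isPreconnected_corner m δ).subset_connectedComponentIn hτ₀ hsub
  have hcl : vertexRZero m ∈ closure (corner m δ) := by
    rw [Metric.mem_closure_iff]
    intro ε hε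
    obtain ⟨τ, h1, h2⟩ := corner_inter_ball_nonempty m hδ hε
    exact ⟨τ, h2, by rw [dist_comm]; exact h1⟩
  have heq : regionUZero m = connectedComponentIn (doubleRegion m) τ₀ := by
    ext τ
    constructor
    · rintro ⟨hτ, hc⟩
      obtain ⟨σ, hσ, hσδ⟩ := Metric.mem_closure_iff.1 hc δ hδ
      have hσc : σ ∈ corner m δ := by
        rw [h]
        exact ⟨by rwa [Metric.mem_ball, dist_comm], connectedComponentIn_subset _ _ hσ⟩
      rw [connectedComponentIn_eq (hcomp hσc), ← connectedComponentIn_eq hσ]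
      exact mem_connectedComponentIn hτ
    · intro hτ
      refine ⟨connectedComponentIn_subset _ _ hτ, ?_⟩
      rw [← connectedComponentIn_eq hτ]
      exact closure_mono hcomp hcl
  rw [heq]
  exact ⟨isPreconnected_connectedComponentIn, hcomp⟩

/-! ### The sheets are sections over the region -/

/-- If the sum vanished, the candidate point would be a microphone at distance `|τᵢ|` from the first
one, making a gap zero. -/
theorem quadRoot_add_ne_zero {m : Fin 3 → EPlane} (hD : crossDisp m ≠ 0) {τ : ℝ × ℝ}
    (h : τ ∈ doubleRegion m) {s : ℝ} (hs : s ^ 2 = 1) :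
    quadRoot m s τ + τ.1 ≠ 0 ∧ quadRoot m s τ + τ.2 ≠ 0 := by
  obtain ⟨⟨g1, g2, -⟩, -⟩ := (mem_doubleRegion_iff hD τ).1 h
  obtain ⟨d0, d1, d2⟩ := dist_sq_pointAt hD (quadRoot_eq hD h hs)
  constructor
  · intro h0
    have hx : pointAt m τ (quadRoot m s τ) = m 1 := by
      rw [h0] at d1
      simpa using d1
    rw [hx, dist_eq_norm, eq_neg_of_add_eq_zero_left h0, neg_sq] at d0
    rw [gap_one_zero] at g1
    exact g1.ne' (sub_eq_zero.2 d0)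
  · intro h0
    have hx : pointAt m τ (quadRoot m s τ) = m 2 := by
      rw [h0] at d2
      simpa using d2
    rw [hx, dist_eq_norm, eq_neg_of_add_eq_zero_left h0, neg_sq] at d0
    rw [gap_two_zero] at g2
    exact g2.ne' (sub_eq_zero.2 d0)

theorem regionUZero_subset (m : Fin 3 → EPlane) : regionUZero m ⊆ doubleRegion m :=
  fun _ h => h.1

theorem quadRoot_add_pos {m : Fin 3 → EPlane} (hD : crossDisp m ≠ 0) {τ : ℝ × ℝ}
    (h : τ ∈ regionUZero m) {s : ℝ} (hs : s ^ 2 = 1) :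
    0 < quadRoot m s τ + τ.1 ∧ 0 < quadRoot m s τ + τ.2 := by
  obtain ⟨δ, hδ, hc, hpos⟩ := exists_corner hD
  obtain ⟨hU, hcU⟩ := isPreconnected_regionUZero_and_corner_subset hδ hc
  obtain ⟨σ, -, hσ⟩ := corner_inter_ball_nonempty m hδ hδ
  have hr := (continuousOn_quadRoot hD s).mono (regionUZero_subset m)
  have h0 := quadRoot_nonneg hD (hcU hσ).1 hs
  constructor
  · exact hU.lt_of_ne (f := fun τ => quadRoot m s τ + τ.1) (by fun_prop)
      (fun x hx => (quadRoot_add_ne_zero hD hx.1 hs).1)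
      ⟨σ, hcU hσ, add_pos_of_nonneg_of_pos h0 (hpos σ hσ).1⟩ h
  · exact hU.lt_of_ne (f := fun τ => quadRoot m s τ + τ.2) (by fun_prop)
      (fun x hx => (quadRoot_add_ne_zero hD hx.1 hs).2)
      ⟨σ, hcU hσ, add_pos_of_nonneg_of_pos h0 (hpos σ hσ).2⟩ h

theorem dist_sheet {m : Fin 3 → EPlane} (hD : crossDisp m ≠ 0) {τ : ℝ × ℝ}
    (h : τ ∈ regionUZero m) {s : ℝ} (hs : s ^ 2 = 1) :
    dist (sheet m s τ) (m 0) = quadRoot m s τ := by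
  obtain ⟨d0, -, -⟩ := dist_sq_pointAt hD (quadRoot_eq hD h.1 hs)
  exact (sq_eq_sq₀ dist_nonneg (quadRoot_nonneg hD h.1 hs)).1 d0

theorem tdoaMap_sheet {m : Fin 3 → EPlane} (hD : crossDisp m ≠ 0) {τ : ℝ × ℝ}
    (h : τ ∈ regionUZero m) {s : ℝ} (hs : s ^ 2 = 1) : tdoaMap m (sheet m s τ) = τ := by
  obtain ⟨-, d1, d2⟩ := dist_sq_pointAt hD (quadRoot_eq hD h.1 hs)
  obtain ⟨p1, p2⟩ := quadRoot_add_pos hD h hs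
  have e1 : dist (sheet m s τ) (m 1) = _ := (sq_eq_sq₀ dist_nonneg p1.le).1 d1
  have e2 : dist (sheet m s τ) (m 2) = _ := (sq_eq_sq₀ dist_nonneg p2.le).1 d2
  rw [tdoaMap, dist_sheet hD h hs, e1, e2]
  simp

theorem sheetSign_sheet {m : Fin 3 → EPlane} (hD : crossDisp m ≠ 0) {τ : ℝ × ℝ}
    (h : τ ∈ regionUZero m) {s : ℝ} (hs : s ^ 2 = 1) :
    0 < s * sheetSign m (sheet m s τ) := by
  rw [sheetSign, tdoaMap_sheet hD h hs, dist_sheet hD h hs, coeffA_mul_quadRoot_sub hD h.1,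
    ← mul_assoc, ← sq, hs, one_mul]
  exact Real.sqrt_pos.2 (quadDisc_pos hD h.1)

theorem sheetSign_ne_zero {m : Fin 3 → EPlane} (hD : crossDisp m ≠ 0) {x : EPlane}
    (hx : tdoaMap m x ∈ doubleRegion m) : sheetSign m x ≠ 0 := by
  intro h
  have h1 := sheetSign_sq m x
  have h2 := quadDisc_pos hD hx
  rw [h] at h1
  simp [← h1] at h2

/-! ### Components of the preimage and the covering -/

theorem image_sheet_eq {m : Fin 3 → EPlane} (hD : crossDisp m ≠ 0) {s : ℝ} (hs : s ^ 2 = 1) :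
    sheet m s '' regionUZero m = {x ∈ preimageUZero m | 0 < s * sheetSign m x} := by
  ext x
  constructor
  · rintro ⟨τ, hτ, rfl⟩
    exact ⟨by rwa [preimageUZero, Set.mem_preimage, tdoaMap_sheet hD hτ hs],
      sheetSign_sheet hD hτ hs⟩
  · rintro ⟨hx, h⟩
    exact ⟨tdoaMap m x, hx, sheet_of_sheetSign hD hx.1 hs h⟩

theorem isPreconnected_image_sheet {m : Fin 3 → EPlane} (hD : crossDisp m ≠ 0) (s : ℝ) :
    IsPreconnected (sheet m s '' regionUZero m) := by
  obtain ⟨δ, hδ, hc, -⟩ := exists_corner hD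
  exact (isPreconnected_regionUZero_and_corner_subset hδ hc).1.image _
    ((continuousOn_sheet hD s).mono (regionUZero_subset m))

theorem injOn_image_sheet {m : Fin 3 → EPlane} (hD : crossDisp m ≠ 0) {s : ℝ} (hs : s ^ 2 = 1) :
    Set.InjOn (tdoaMap m) (sheet m s '' regionUZero m) := by
  rintro _ ⟨τ, hτ, rfl⟩ _ ⟨σ, hσ, rfl⟩ h
  rw [tdoaMap_sheet hD hτ hs, tdoaMap_sheet hD hσ hs] at h
  rw [h]

/-- A connected subset of the preimage cannot change the sign of `sheetSign`, while each sheet is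
connected as a continuous image of `U₀`. -/
theorem connectedComponentIn_preimageUZero {m : Fin 3 → EPlane} (hD : crossDisp m ≠ 0) {s : ℝ}
    (hs : s ^ 2 = 1) {x : EPlane} (hx : x ∈ sheet m s '' regionUZero m) :
    connectedComponentIn (preimageUZero m) x = sheet m s '' regionUZero m := by
  have hsub : sheet m s '' regionUZero m ⊆ preimageUZero m := by
    rw [image_sheet_eq hD hs]; exact fun _ h => h.1
  apply Set.Subset.antisymm
  · intro y hy
    have hc : Continuous fun x => s * sheetSign m x :=
      continuous_const.mul (continuous_sheetSign m)
    have hs0 : s ≠ 0 := by rintro rfl; norm_num at hs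
    rw [image_sheet_eq hD hs] at hx ⊢
    refine ⟨connectedComponentIn_subset _ _ hy, ?_⟩
    exact isPreconnected_connectedComponentIn.lt_of_ne hc.continuousOn
      (fun z hz => mul_ne_zero hs0
        (sheetSign_ne_zero hD (connectedComponentIn_subset (preimageUZero m) x hz).1))
      ⟨x, mem_connectedComponentIn hx.1, hx.2⟩ hy
  · exact (isPreconnected_image_sheet hD s).subset_connectedComponentIn hx hsub

theorem preimageUZero_eq_union {m : Fin 3 → EPlane} (hD : crossDisp m ≠ 0) :
    preimageUZero m = sheet m 1 '' regionUZero m ∪ sheet m (-1) '' regionUZero m := by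
  rw [image_sheet_eq hD (by norm_num), image_sheet_eq hD (by norm_num)]
  ext x
  constructor
  · intro hx
    rcases lt_or_gt_of_ne (sheetSign_ne_zero hD hx.1) with h | h
    · exact Or.inr ⟨hx, by linarith⟩
    · exact Or.inl ⟨hx, by linarith⟩
  · rintro (h | h) <;> exact h.1

theorem regionUZero_nonempty {m : Fin 3 → EPlane} (hD : crossDisp m ≠ 0) :
    (regionUZero m).Nonempty := by
  obtain ⟨δ, hδ, hc, -⟩ := exists_corner hD
  obtain ⟨σ, -, hσ⟩ := corner_inter_ball_nonempty m hδ hδ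
  exact ⟨σ, (isPreconnected_regionUZero_and_corner_subset hδ hc).2 hσ⟩

theorem componentsOf_preimageUZero {m : Fin 3 → EPlane} (hD : crossDisp m ≠ 0) :
    componentsOf (preimageUZero m)
      = {sheet m 1 '' regionUZero m, sheet m (-1) '' regionUZero m} := by
  obtain ⟨σ, hσ⟩ := regionUZero_nonempty hD
  ext C
  constructor
  · rintro ⟨x, hx, rfl⟩
    rw [preimageUZero_eq_union hD] at hx
    rcases hx with hx | hx
    · exact Or.inl (connectedComponentIn_preimageUZero hD (by norm_num) hx)
    · exact Or.inr (connectedComponentIn_preimageUZero hD (by norm_num) hx)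
  · rintro (rfl | rfl)
    · have hx := Set.mem_image_of_mem (sheet m 1) hσ
      exact ⟨_, by rw [preimageUZero_eq_union hD]; exact Or.inl hx,
        (connectedComponentIn_preimageUZero hD (by norm_num) hx).symm⟩
    · have hx := Set.mem_image_of_mem (sheet m (-1)) hσ
      exact ⟨_, by rw [preimageUZero_eq_union hD]; exact Or.inr hx,
        (connectedComponentIn_preimageUZero hD (by norm_num) hx).symm⟩

theorem sheet_one_ne_sheet_neg_one {m : Fin 3 → EPlane} (hD : crossDisp m ≠ 0) {τ σ : ℝ × ℝ}
    (hτ : τ ∈ regionUZero m) (hσ : σ ∈ regionUZero m) : sheet m 1 τ ≠ sheet m (-1) σ := by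
  intro h
  have h1 := sheetSign_sheet hD hτ (s := 1) (by norm_num)
  have h2 := sheetSign_sheet hD hσ (s := -1) (by norm_num)
  rw [h] at h1
  linarith

theorem fibre_eq_pair {m : Fin 3 → EPlane} (hD : crossDisp m ≠ 0) {τ : ℝ × ℝ}
    (h : τ ∈ regionUZero m) : tdoaMap m ⁻¹' {τ} = {sheet m 1 τ, sheet m (-1) τ} := by
  ext x
  constructor
  · rintro rfl
    rcases lt_or_gt_of_ne (sheetSign_ne_zero hD h.1) with h' | h'
    · exact Or.inr (sheet_of_sheetSign hD h.1 (by norm_num) (by linarith)).symm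
    · exact Or.inl (sheet_of_sheetSign hD h.1 (by norm_num) (by linarith)).symm
  · rintro (rfl | rfl) <;> exact tdoaMap_sheet hD h (by norm_num)

/-- Over `regionUZero m` the range difference map is a trivial double cover. -/
def sheetHomeomorph {m : Fin 3 → EPlane} (hD : crossDisp m ≠ 0) :
    preimageUZero m ≃ₜ regionUZero m × Bool where
  toFun x := (⟨tdoaMap m x, x.2⟩, decide (0 < sheetSign m x))
  invFun p := ⟨sheet m (if p.2 then 1 else -1) p.1, by
    rw [preimageUZero, Set.mem_preimage, tdoaMap_sheet hD p.1.2 (by split_ifs <;> norm_num)]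
    exact p.1.2⟩
  left_inv x := by
    apply Subtype.ext
    rcases lt_or_gt_of_ne (sheetSign_ne_zero hD x.2.1) with h | h
    · simpa [h.le.not_gt] using
        sheet_of_sheetSign hD x.2.1 (s := -1) (by norm_num) (by linarith)
    · simpa [h] using sheet_of_sheetSign hD x.2.1 (s := 1) (by norm_num) (by linarith)
  right_inv p := by
    obtain ⟨τ, b⟩ := p
    cases b
    · have h1 := tdoaMap_sheet hD τ.2 (s := -1) (by norm_num)
      have h2 := sheetSign_sheet hD τ.2 (s := -1) (by norm_num)
      have h3 : sheetSign m (sheet m (-1) τ) ≤ 0 := by linarith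
      simp [h1, h3]
    · have h1 := tdoaMap_sheet hD τ.2 (s := 1) (by norm_num)
      have h2 := sheetSign_sheet hD τ.2 (s := 1) (by norm_num)
      have h3 : 0 < sheetSign m (sheet m 1 τ) := by linarith
      simp [h1, h3]
  continuous_toFun := by
    refine Continuous.prodMk (((continuous_tdoaMap m).comp continuous_subtype_val).subtype_mk _) ?_
    have hc := (continuous_sheetSign m).comp (continuous_subtype_val (p := (· ∈ preimageUZero m)))
    refine continuous_bool_rng true |>.2 ?_
    have e : (fun x : preimageUZero m => decide (0 < sheetSign m x)) ⁻¹' {true}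
        = {x : preimageUZero m | 0 < sheetSign m x} := by ext; simp
    rw [e]
    refine ⟨?_, isOpen_lt continuous_const hc⟩
    -- Since `sheetSign` has no zero on the preimage, its positivity set is closed as well as open.
    have e' : {x : preimageUZero m | 0 < sheetSign m x}
        = {x : preimageUZero m | 0 ≤ sheetSign m x} := by
      ext x
      exact ⟨fun (h : 0 < sheetSign m x) => h.le, fun h => lt_of_le_of_ne h (sheetSign_ne_zero hD x.2.1).symm⟩
    rw [e']
    exact isClosed_le continuous_const hc
  continuous_invFun := by
    refine Continuous.subtype_mk ?_ _
    rw [continuous_prod_of_discrete_right]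
    intro b
    exact ((continuousOn_sheet hD (if b then 1 else -1)).mono
      (regionUZero_subset m)).domRestrict

theorem isCoveringMap_restrictPreimage_tdoaMap {m : Fin 3 → EPlane} (hD : crossDisp m ≠ 0) :
    IsCoveringMap ((regionUZero m).restrictPreimage (tdoaMap m)) := by
  intro τ
  have h : IsEvenlyCovered ((regionUZero m).restrictPreimage (tdoaMap m)) τ Bool := by
    -- The whole base serves as evenly covered neighbourhood, because the cover is globally trivial.
    refine ⟨inferInstance, Set.univ, Set.mem_univ _, isOpen_univ, isOpen_univ,
      (Homeomorph.Set.univ _).trans ((sheetHomeomorph hD).trans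
        (Homeomorph.prodCongr (Homeomorph.Set.univ _).symm (Homeomorph.refl _))), ?_⟩
    intro x
    rfl
  exact h.to_isEvenlyCovered_preimage

/-! ### The sector bounded by the two rays -/

/-- The coordinate along `m 0 - m 1` in the affine frame of the three microphones. -/
def sectorCoordOne (m : Fin 3 → EPlane) (x : EPlane) : ℝ :=
  ((x 1 - m 0 1) * disp m 2 0 0 - (x 0 - m 0 0) * disp m 2 0 1) / crossDisp m

/-- The coordinate along `m 0 - m 2` in the affine frame of the three microphones. -/
def sectorCoordTwo (m : Fin 3 → EPlane) (x : EPlane) : ℝ :=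
  ((x 0 - m 0 0) * disp m 1 0 1 - (x 1 - m 0 1) * disp m 1 0 0) / crossDisp m

/-- The open convex sector bounded by the two half-lines. -/
def sector (m : Fin 3 → EPlane) : Set EPlane :=
  {x | 0 < sectorCoordOne m x ∧ 0 < sectorCoordTwo m x}

/-- The complement of the closed convex sector bounded by the two half-lines. -/
def coSector (m : Fin 3 → EPlane) : Set EPlane :=
  {x | sectorCoordOne m x < 0 ∨ sectorCoordTwo m x < 0}

theorem continuous_sectorCoordOne (m : Fin 3 → EPlane) : Continuous (sectorCoordOne m) := by
  unfold sectorCoordOne; fun_prop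

theorem continuous_sectorCoordTwo (m : Fin 3 → EPlane) : Continuous (sectorCoordTwo m) := by
  unfold sectorCoordTwo; fun_prop

theorem isOpen_sector (m : Fin 3 → EPlane) : IsOpen (sector m) :=
  (isOpen_lt continuous_const (continuous_sectorCoordOne m)).inter
    (isOpen_lt continuous_const (continuous_sectorCoordTwo m))

theorem isOpen_coSector (m : Fin 3 → EPlane) : IsOpen (coSector m) :=
  (isOpen_lt (continuous_sectorCoordOne m) continuous_const).union
    (isOpen_lt (continuous_sectorCoordTwo m) continuous_const)

theorem disjoint_sector_coSector (m : Fin 3 → EPlane) : Disjoint (sector m) (coSector m) := by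
  rw [Set.disjoint_left]
  rintro x ⟨h1, h2⟩ (h | h) <;> linarith

theorem eq_sectorCoord {m : Fin 3 → EPlane} (hD : crossDisp m ≠ 0) (x : EPlane) :
    x = m 0 + sectorCoordOne m x • (m 0 - m 1) + sectorCoordTwo m x • (m 0 - m 2) := by
  have hC : crossDisp m = disp m 1 0 0 * disp m 2 0 1 - disp m 1 0 1 * disp m 2 0 0 := rfl
  simp only [disp_apply] at hC
  ext k
  fin_cases k
  · simp only [Fin.zero_eta, PiLp.add_apply, PiLp.smul_apply, PiLp.sub_apply, smul_eq_mul,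
      sectorCoordOne, sectorCoordTwo, disp_apply]
    field_simp
    rw [hC]; ring
  · simp only [Fin.mk_one, PiLp.add_apply, PiLp.smul_apply, PiLp.sub_apply, smul_eq_mul,
      sectorCoordOne, sectorCoordTwo, disp_apply]
    field_simp
    rw [hC]; ring

theorem compl_rays_subset {m : Fin 3 → EPlane} (hD : crossDisp m ≠ 0) :
    (rOnePlus m ∪ rTwoPlus m)ᶜ ⊆ sector m ∪ coSector m := by
  intro x hx
  by_contra h
  simp only [sector, coSector, Set.mem_union, Set.mem_ofPred_eq, not_or, not_and, not_lt] at h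
  obtain ⟨h1, h2, h3⟩ := h
  have e := eq_sectorCoord hD x
  apply hx
  rcases h2.eq_or_lt with h0 | h0
  · rw [← h0, zero_smul, add_zero] at e
    exact Or.inl ⟨_, h3, e⟩
  · rw [le_antisymm (h1 h0) h3, zero_smul, add_zero] at e
    exact Or.inr ⟨_, h2, e⟩

theorem dist_sub_dist_of_mem_halfLineAway {p q x : EPlane} (h : x ∈ halfLineAway p q) :
    dist x q - dist x p = ‖q - p‖ := by
  obtain ⟨t, ht, rfl⟩ := h
  have e : p + t • (p - q) - q = (1 + t) • (p - q) := by module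
  rw [dist_eq_norm, dist_eq_norm, add_sub_cancel_left, e, norm_smul, norm_smul, Real.norm_eq_abs,
    Real.norm_eq_abs, abs_of_nonneg ht, abs_of_nonneg (by linarith), norm_sub_rev q p]
  ring

theorem preimageUZero_subset_compl_rays {m : Fin 3 → EPlane} (hD : crossDisp m ≠ 0) :
    preimageUZero m ⊆ (rOnePlus m ∪ rTwoPlus m)ᶜ := by
  intro x hx hr
  obtain ⟨⟨g1, g2, -⟩, -⟩ := (mem_doubleRegion_iff hD _).1 hx.1
  rcases hr with hr | hr
  · have h := dist_sub_dist_of_mem_halfLineAway hr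
    rw [gap_two_zero, tdoaMap] at g2
    simp [h, disp] at g2
  · have h := dist_sub_dist_of_mem_halfLineAway hr
    rw [gap_one_zero, tdoaMap] at g1
    simp [h, disp] at g1

/-- This bridges the algebraic sign and the geometry: the right side can be compared with the
triangle inequality. -/
theorem sheetSign_eq {m : Fin 3 → EPlane} (hD : crossDisp m ≠ 0) (x : EPlane) :
    sheetSign m x = crossDisp m ^ 2 * (sectorCoordOne m x * (tdoaMap m x).1
      + sectorCoordTwo m x * (tdoaMap m x).2 - dist x (m 0)) := by
  obtain ⟨h1, h2⟩ := inner_of_tdoaMap_eq (m := m) (x := x) rfl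
  rw [sheetSign]
  generalize tdoaMap m x = τ at *
  rw [coeffA_coords, quadB_coords, sectorCoordOne, sectorCoordTwo]
  have hC : crossDisp m = disp m 1 0 0 * disp m 2 0 1 - disp m 1 0 1 * disp m 2 0 0 := rfl
  have g1 : gap m 1 0 τ = 2 * ((x 0 - m 0 0) * disp m 1 0 0 + (x 1 - m 0 1) * disp m 1 0 1
    + dist x (m 0) * τ.1) := by linear_combination -2 * h1
  have g2 : gap m 2 0 τ = 2 * ((x 0 - m 0 0) * disp m 2 0 0 + (x 1 - m 0 1) * disp m 2 0 1
    + dist x (m 0) * τ.2) := by linear_combination -2 * h2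
  rw [g1, g2]
  field_simp
  rw [hC]
  ring

theorem sheetSign_nonneg_of_mem_sector {m : Fin 3 → EPlane} (hD : crossDisp m ≠ 0) {x : EPlane}
    (hx : x ∈ sector m) : 0 ≤ sheetSign m x := by
  obtain ⟨h1, h2⟩ := hx
  have e := eq_sectorCoord hD x
  rw [sheetSign_eq hD, tdoaMap]
  generalize sectorCoordOne m x = α at *
  generalize sectorCoordTwo m x = β at *
  -- Norms of both sides give `(1 + α + β) d₀ ≤ α d₁ + β d₂`, that is, `d₀ ≤ α τ₁ + β τ₂`.
  have e' : α • (x - m 1) + β • (x - m 2) = (1 + α + β) • (x - m 0) := by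
    have : x - m 0 = α • (m 0 - m 1) + β • (m 0 - m 2) := by
      nth_rewrite 1 [e]; module
    calc α • (x - m 1) + β • (x - m 2)
        = (α + β) • (x - m 0) + (α • (m 0 - m 1) + β • (m 0 - m 2)) := by module
      _ = (1 + α + β) • (x - m 0) := by rw [← this]; module
  have hn := norm_add_le (α • (x - m 1)) (β • (x - m 2))
  rw [e', norm_smul, norm_smul, norm_smul, Real.norm_of_nonneg h1.le, Real.norm_of_nonneg h2.le,
    Real.norm_of_nonneg (by linarith), ← dist_eq_norm, ← dist_eq_norm, ← dist_eq_norm] at hn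
  apply mul_nonneg (sq_nonneg _)
  linarith

theorem norm_sub_sub_norm_lt {z w : EPlane} (h : z 0 * w 1 - z 1 * w 0 ≠ 0) :
    ‖z - w‖ - ‖z‖ < ‖w‖ := by
  have h1 := neg_lt_of_abs_lt (abs_inner_lt_of_cross_ne_zero h)
  rw [sub_lt_iff_lt_add]
  apply lt_of_pow_lt_pow_left₀ 2 (by positivity)
  rw [norm_sub_sq_real]
  nlinarith

theorem exists_mem_sector_tdoaMap_mem_corner {m : Fin 3 → EPlane} (hD : crossDisp m ≠ 0) {δ : ℝ}
    (hδ : 0 < δ) : ∃ x ∈ sector m, tdoaMap m x ∈ corner m δ := by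
  have hC : crossDisp m = disp m 1 0 0 * disp m 2 0 1 - disp m 1 0 1 * disp m 2 0 0 := rfl
  -- This path leaves `m 0`, whose image is the vertex, along the direction with both sector
  -- coordinates equal to `t`. Off the lines through the microphones the triangle inequality is
  -- strict, so the image enters the corner.
  set p : ℝ → EPlane := fun t => m 0 - t • (disp m 1 0 + disp m 2 0) with hp
  have hR : tdoaMap m (p 0) = vertexRZero m := by
    simp [hp, tdoaMap, vertexRZero, disp, dist_eq_norm, norm_sub_rev]
  have hc : Continuous fun t => tdoaMap m (p t) := (continuous_tdoaMap m).comp (by fun_prop)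
  have ht : Filter.Tendsto (fun t => tdoaMap m (p t)) (nhdsWithin 0 (Set.Ioi 0))
      (nhds (vertexRZero m)) := by
    rw [← hR]; exact (hc.tendsto 0).mono_left nhdsWithin_le_nhds
  obtain ⟨t, htb, ht0⟩ := ((ht.eventually (Metric.ball_mem_nhds _ hδ)).and
    self_mem_nhdsWithin).exists
  replace ht0 : 0 < t := ht0
  have hz : ∀ k, p t k - m 0 k = -(t * (disp m 1 0 k + disp m 2 0 k)) := by
    intro k; simp [hp]; ring
  refine ⟨p t, ⟨?_, ?_⟩, htb, ?_, ?_⟩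
  · have : sectorCoordOne m (p t) = t := by
      rw [sectorCoordOne, hz, hz, div_eq_iff hD, hC]; ring
    rwa [this]
  · have : sectorCoordTwo m (p t) = t := by
      rw [sectorCoordTwo, hz, hz, div_eq_iff hD, hC]; ring
    rwa [this]
  · have hne : (p t - m 0) 0 * disp m 1 0 1 - (p t - m 0) 1 * disp m 1 0 0 ≠ 0 := by
      change (p t 0 - m 0 0) * _ - (p t 1 - m 0 1) * _ ≠ 0
      rw [hz, hz]
      have : t * crossDisp m ≠ 0 := mul_ne_zero ht0.ne' hD
      rw [hC] at this
      intro h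
      exact this (by linear_combination h)
    have e : p t - m 0 - disp m 1 0 = p t - m 1 := by simp [disp]
    have := norm_sub_sub_norm_lt hne
    rwa [e, ← dist_eq_norm, ← dist_eq_norm] at this
  · have hne : (p t - m 0) 0 * disp m 2 0 1 - (p t - m 0) 1 * disp m 2 0 0 ≠ 0 := by
      change (p t 0 - m 0 0) * _ - (p t 1 - m 0 1) * _ ≠ 0
      rw [hz, hz]
      have : t * crossDisp m ≠ 0 := mul_ne_zero ht0.ne' hD
      rw [hC] at this
      intro h
      exact this (by linear_combination -h)
    have e : p t - m 0 - disp m 2 0 = p t - m 2 := by simp [disp]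
    have := norm_sub_sub_norm_lt hne
    rwa [e, ← dist_eq_norm, ← dist_eq_norm] at this

/-- One point suffices: the sheet is connected and avoids the rays, so it cannot cross the boundary
of the sector. -/
theorem image_sheet_one_subset_sector {m : Fin 3 → EPlane} (hD : crossDisp m ≠ 0) :
    sheet m 1 '' regionUZero m ⊆ sector m := by
  obtain ⟨δ, hδ, hc, -⟩ := exists_corner hD
  obtain ⟨x, hxS, hxc⟩ := exists_mem_sector_tdoaMap_mem_corner hD hδ
  have hxU : x ∈ preimageUZero m := (isPreconnected_regionUZero_and_corner_subset hδ hc).2 hxc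
  have hsub : sheet m 1 '' regionUZero m ⊆ sector m ∪ coSector m := by
    refine Set.Subset.trans ?_ (compl_rays_subset hD)
    refine Set.Subset.trans ?_ (preimageUZero_subset_compl_rays hD)
    rw [preimageUZero_eq_union hD]
    exact Set.subset_union_left
  refine (isPreconnected_image_sheet hD 1).subset_left_of_subset_union (isOpen_sector m)
    (isOpen_coSector m) (disjoint_sector_coSector m) hsub ⟨x, ?_, hxS⟩
  rw [image_sheet_eq hD (by norm_num)]
  refine ⟨hxU, ?_⟩
  rw [one_mul]
  exact lt_of_le_of_ne (sheetSign_nonneg_of_mem_sector hD hxS) (sheetSign_ne_zero hD hxU.1).symm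

theorem image_sheet_neg_one_disjoint_sector {m : Fin 3 → EPlane} (hD : crossDisp m ≠ 0)
    {x : EPlane} (hx : x ∈ sheet m (-1) '' regionUZero m) : x ∉ sector m := by
  intro hS
  rw [image_sheet_eq hD (by norm_num)] at hx
  have h1 := sheetSign_nonneg_of_mem_sector hD hS
  have h2 := hx.2
  linarith

theorem separates_sheets {m : Fin 3 → EPlane} (hD : crossDisp m ≠ 0) :
    Separates (rOnePlus m ∪ rTwoPlus m) (sheet m 1 '' regionUZero m)
      (sheet m (-1) '' regionUZero m) := by
  obtain ⟨σ, hσ⟩ := regionUZero_nonempty hD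
  have ha := Set.mem_image_of_mem (sheet m 1) hσ
  have hb := Set.mem_image_of_mem (sheet m (-1)) hσ
  have hU := preimageUZero_subset_compl_rays hD
  rw [preimageUZero_eq_union hD, Set.union_subset_iff] at hU
  refine ⟨_, ⟨_, hU.1 ha, rfl⟩, _, ⟨_, hU.2 hb, rfl⟩, ?_,
    (isPreconnected_image_sheet hD 1).subset_connectedComponentIn ha hU.1,
    (isPreconnected_image_sheet hD (-1)).subset_connectedComponentIn hb hU.2⟩
  intro heq
  -- Off the rays the sector is open and closed, so the component containing the positive sheet
  -- stays in it, which excludes the negative sheet.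
  have hsub := isPreconnected_connectedComponentIn.subset_left_of_subset_union (isOpen_sector m)
    (isOpen_coSector m) (disjoint_sector_coSector m)
    ((connectedComponentIn_subset _ (sheet m 1 σ)).trans (compl_rays_subset hD))
    ⟨_, mem_connectedComponentIn (hU.1 ha), image_sheet_one_subset_sector hD ha⟩
  exact image_sheet_neg_one_disjoint_sector hD hb
    (hsub (heq ▸ mem_connectedComponentIn (hU.2 hb)))


end

theorem mainTheorem5 (m : Fin 3 → EPlane) (hm : ¬ Collinear ℝ (Set.range m)) :
    (∃ A B : Set EPlane, A ≠ B ∧ componentsOf (preimageUZero m) = {A, B} ∧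
      Separates (rOnePlus m ∪ rTwoPlus m) A B ∧
      Set.InjOn (tdoaMap m) A ∧ Set.InjOn (tdoaMap m) B) ∧
    IsCoveringMap ((regionUZero m).restrictPreimage (tdoaMap m)) ∧
    ∀ τ ∈ regionUZero m, (tdoaMap m ⁻¹' {τ}).ncard = 2 := by
  have hD := crossDisp_ne_zero hm
  obtain ⟨σ, hσ⟩ := regionUZero_nonempty hD
  refine ⟨⟨sheet m 1 '' regionUZero m, sheet m (-1) '' regionUZero m, ?_,
    componentsOf_preimageUZero hD, separates_sheets hD, injOn_image_sheet hD (by norm_num),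
    injOn_image_sheet hD (by norm_num)⟩, isCoveringMap_restrictPreimage_tdoaMap hD, ?_⟩
  · intro h
    obtain ⟨τ, hτ, e⟩ := h ▸ Set.mem_image_of_mem (sheet m 1) hσ
    exact sheet_one_ne_sheet_neg_one hD hσ hτ e.symm
  · intro τ hτ
    rw [fibre_eq_pair hD hτ, Set.ncard_pair (sheet_one_ne_sheet_neg_one hD hτ hτ)]
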